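/- Let $\mathcal A$ be a unital $C^*$-algebra. Let $H_{\mathcal A}=\ell^2(\mathcal A)$ be the standard Hilbert $\mathcal A$-module: the sequences $x=(x_i)_{i\in\mathbb N}$ in $\mathcal A$ for which $\sum_i x_ix_i^*$ converges in norm, regarded as a left $\mathcal A$-module with inner product $\langle x,y\rangle=\sum_i y_ix_i^*$ and norm $\|x\|=\|\langle x,x\rangle\|^{1/2}$. (The convention with right modules is the same statement for the opposite algebra.) Let $B^a(H_{\mathcal A})$ be the algebra of bounded adjointable operators on $H_{\mathcal A}$ with the operator norm, and let $K(H_{\mathcal A})\subseteq B^a(H_{\mathcal A})$ be the compact operators, i.e. the closed linear span of the operators $\theta_{x,y}\colon z\mapsto\langle y,z\rangle x$, $x,y\in H_{\mathcal A}$. Isomorphisms of modules are bounded $\mathcal A$-linear bijections with bounded inverse. For $F\in B^a(H_{\mathcal A})$, a *decomposition* $$H_{\mathcal A}=M_1\tilde\oplus N_1\stackrel{F}{\longrightarrow}M_2\tilde\oplus N_2=H_{\mathcal A}$$ consists of closed submodules $M_1,N_1,M_2,N_2$ of $H_{\mathcal A}$ such that $H_{\mathcal A}$ is the direct (not necessarily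 orthogonal) sum of $M_1$ and $N_1$ and of $M_2$ and $N_2$, $F$ restricts to an isomorphism $F_1\colon M_1\to M_2$, and $F(N_1)\subseteq N_2$; that is, $F$ has the matrix $\begin{pmatrix}F_1&0\\0&F_4\end{pmatrix}$ with $F_1$ an isomorphism. For closed submodules write $N\preceq N'$ if $N$ is isomorphic to a closed submodule of $N'$. A submodule is finitely generated if it is the $\mathcal A$-linear span of a finite set. Let - $\mathcal M\Phi_+(H_{\mathcal A})$ (respectively $\mathcal M\Phi_-(H_{\mathcal A})$) be the set of $F\in B^a(H_{\mathcal A})$ that have a decomposition with $N_1$ (respectively $N_2$) finitely generated; - ${\mathcal M\Phi_+^-}'(H_{\mathcal A})$ be the set of $F\in\mathcal M\Phi_+(H_{\mathcal A})$ that have a decomposition with $N_1$ finitely generated and $N_1\preceq N_2$; - ${\mathcal M\Phi_-^+}'(H_{\mathcal A})$ be the set of $F\in\mathcal M\Phi_-(H_{\mathcal A})$ that have a decomposition with $N_2$ finitely generated and $N_2\preceq N_1$. **Lemma 5.9.** The sets ${\mathcal M\Phi_+^-}'(H_{\mathcal A})$ and ${\mathcal M\Phi_-^+}'(H_{\mathcal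 A})$ are open in $B^a(H_{\mathcal A})$ in the norm topology. Moreover, if $F\in{\mathcal M\Phi_+^-}'(H_{\mathcal A})$ and $K\in K(H_{\mathcal A})$, then $F+K\in{\mathcal M\Phi_+^-}'(H_{\mathcal A})$; and if $F\in{\mathcal M\Phi_-^+}'(H_{\mathcal A})$ and $K\in K(H_{\mathcal A})$, then $F+K\in{\mathcal M\Phi_-^+}'(H_{\mathcal A})$. -/

import Mathlib

namespace HilbertModule

open scoped InnerProductSpace

/-! ### Operators on a Hilbert C⋆-module -/

section Operators

variable (A E : Type*) [CStarAlgebra A] [PartialOrder A] [StarOrderedRing A]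
  [NormedAddCommGroup E] [NormedSpace ℂ E] [Module A E] [CStarModule A E]

/-- The algebra of bounded adjointable operators on the Hilbert `A`-module `E`, with the operator
norm. Adjointable operators are automatically `A`-linear, see `HilbertModule.adjointable_map_smul`
below. -/
def adjointable : Subalgebra ℂ (E →L[ℂ] E) where
  carrier := {T | ∃ S : E →L[ℂ] E, ∀ x y : E, ⟪T x, y⟫_A = ⟪x, S y⟫_A}
  mul_mem' := by
    rintro T₁ T₂ ⟨S₁, h₁⟩ ⟨S₂, h₂⟩
    exact ⟨S₂ * S₁, fun x y => by
      rw [mul_apply_eq_comp, mul_apply_eq_comp, h₁, h₂]⟩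
  add_mem' := by
    rintro T₁ T₂ ⟨S₁, h₁⟩ ⟨S₂, h₂⟩
    exact ⟨S₁ + S₂, fun x y => by
      rw [add_apply, add_apply,
        CStarModule.inner_add_left, CStarModule.inner_add_right, h₁, h₂]⟩
  algebraMap_mem' := fun c => ⟨algebraMap ℂ (E →L[ℂ] E) (star c), fun x y => by
    simp [Algebra.algebraMap_eq_smul_one]⟩

variable {A E}

theorem eq_of_inner_right {u v : E} (h : ∀ y : E, ⟪u, y⟫_A = ⟪v, y⟫_A) : u = v := by
  have h' : ⟪u - v, u - v⟫_A = 0 := by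
    rw [CStarModule.inner_sub_left, h, sub_self]
  exact sub_eq_zero.mp (CStarModule.inner_self.mp h')

theorem adjointable_map_smul (T : adjointable A E) (a : A) (x : E) :
    (T : E →L[ℂ] E) (a • x) = a • (T : E →L[ℂ] E) x := by
  obtain ⟨S, hS⟩ := T.2
  refine eq_of_inner_right (A := A) fun y => ?_
  rw [hS, CStarModule.inner_op_smul_left, CStarModule.inner_op_smul_left, hS]

theorem norm_smul_le_mul (a : A) (x : E) : ‖a • x‖ ≤ ‖a‖ * ‖x‖ := by
  refine abs_le_of_sq_le_sq' ?_ (by positivity) |>.2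
  rw [mul_pow, CStarModule.norm_sq_eq A (x := a • x), CStarModule.norm_sq_eq A (x := x),
    CStarModule.inner_op_smul_left, CStarModule.inner_op_smul_right]
  calc ‖a * ⟪x, x⟫_A * star a‖ ≤ ‖a * ⟪x, x⟫_A‖ * ‖star a‖ := norm_mul_le _ _
    _ ≤ (‖a‖ * ‖⟪x, x⟫_A‖) * ‖star a‖ := by gcongr; exact norm_mul_le _ _
    _ = ‖a‖ ^ 2 * ‖⟪x, x⟫_A‖ := by rw [norm_star]; ring

theorem smul_complex_smul (z : ℂ) (a : A) (x : E) : (z • a) • x = z • (a • x) := by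
  refine eq_of_inner_right (A := A) fun y => ?_
  simp

/-- The elementary operator `z ↦ ⟨y, z⟩ x`, as a bounded operator. -/
noncomputable def rankOneCLM (x y : E) : E →L[ℂ] E :=
  LinearMap.mkContinuous
    { toFun := fun z => ⟪y, z⟫_A • x
      map_add' := fun z w => by rw [CStarModule.inner_add_right, add_smul]
      map_smul' := fun c z => by
        rw [CStarModule.inner_smul_right_complex, smul_complex_smul, RingHom.id_apply] }
    (‖y‖ * ‖x‖) fun z => by
      refine (norm_smul_le_mul (A := A) _ x).trans ?_
      calc ‖⟪y, z⟫_A‖ * ‖x‖ ≤ (‖y‖ * ‖z‖) * ‖x‖ := by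
            gcongr; exact CStarModule.norm_inner_le E
        _ = ‖y‖ * ‖x‖ * ‖z‖ := by ring

/-- The elementary operator `θ_{x,y} : z ↦ ⟨y, z⟩ x`, as an adjointable operator. -/
noncomputable def rankOne (x y : E) : adjointable A E :=
  ⟨rankOneCLM (A := A) x y, rankOneCLM (A := A) y x, fun z w => by
    change ⟪⟪y, z⟫_A • x, w⟫_A = ⟪z, ⟪x, w⟫_A • y⟫_A
    simp⟩

variable (A E) in
/-- The compact operators on the Hilbert `A`-module `E`: the closed linear span of the elementary
operators `θ_{x,y}` inside the adjointable operators. -/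
noncomputable def compactOperators : Submodule ℂ (adjointable A E) :=
  (Submodule.span ℂ
    (Set.range fun p : E × E => (rankOne p.1 p.2 : adjointable A E))).topologicalClosure

/-- `N ⪯ N'`: the submodule `N` is isomorphic to a closed submodule of `N'`. Isomorphisms are
bounded `A`-linear bijections with bounded inverse. -/
def Preceq (N N' : Submodule A E) : Prop :=
  ∃ P : Submodule A E, P ≤ N' ∧ IsClosed (P : Set E) ∧ Nonempty (N ≃L[A] P)

/-- `E = M₁ ⊕ N₁ → M₂ ⊕ N₂ = E` is a pair of (not necessarily orthogonal) direct sum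
decompositions into closed submodules, with respect to which `F` has a diagonal matrix
`diag(F₁, F₄)` where `F₁ : M₁ → M₂` is an isomorphism. -/
structure IsDecomposition (F : adjointable A E) (M₁ N₁ M₂ N₂ : Submodule A E) : Prop where
  closed_M₁ : IsClosed (M₁ : Set E)
  closed_N₁ : IsClosed (N₁ : Set E)
  closed_M₂ : IsClosed (M₂ : Set E)
  closed_N₂ : IsClosed (N₂ : Set E)
  isCompl_domain : IsCompl M₁ N₁
  isCompl_codomain : IsCompl M₂ N₂
  /-- `F` maps `M₁` isomorphically onto `M₂`. -/
  iso : ∃ F₁ : M₁ ≃L[A] M₂, ∀ x : M₁, (F₁ x : E) = (F : E →L[ℂ] E) x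
  /-- `F` maps `N₁` into `N₂`. -/
  mapsTo : ∀ x ∈ N₁, (F : E →L[ℂ] E) x ∈ N₂

variable (A E)

/-- The upper semi-`A`-Fredholm operators `MΦ₊(E)`. -/
def upperSemiFredholm : Set (adjointable A E) :=
  {F | ∃ M₁ N₁ M₂ N₂ : Submodule A E, IsDecomposition F M₁ N₁ M₂ N₂ ∧ N₁.FG}

/-- The lower semi-`A`-Fredholm operators `MΦ₋(E)`. -/
def lowerSemiFredholm : Set (adjointable A E) :=
  {F | ∃ M₁ N₁ M₂ N₂ : Submodule A E, IsDecomposition F M₁ N₁ M₂ N₂ ∧ N₂.FG}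

/-- The class `MΦ₊⁻′(E)`. -/
def upperMinusPrime : Set (adjointable A E) :=
  {F | F ∈ upperSemiFredholm A E ∧ ∃ M₁ N₁ M₂ N₂ : Submodule A E,
    IsDecomposition F M₁ N₁ M₂ N₂ ∧ N₁.FG ∧ Preceq N₁ N₂}

/-- The class `MΦ₋⁺′(E)`. -/
def lowerPlusPrime : Set (adjointable A E) :=
  {F | F ∈ lowerSemiFredholm A E ∧ ∃ M₁ N₁ M₂ N₂ : Submodule A E,
    IsDecomposition F M₁ N₁ M₂ N₂ ∧ N₂.FG ∧ Preceq N₂ N₁}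

end Operators

/-! ### The standard module -/

section Standard

variable {A : Type*} [CStarAlgebra A] [PartialOrder A] [StarOrderedRing A]

theorem summable_of_nonneg_of_le {ι : Type*} {f g : ι → A} (hf : ∀ i, 0 ≤ f i)
    (hfg : ∀ i, f i ≤ g i) (hg : Summable g) : Summable f := by
  rw [summable_iff_vanishing_norm] at hg ⊢
  intro ε hε
  obtain ⟨s, hs⟩ := hg ε hε
  refine ⟨s, fun t ht => lt_of_le_of_lt ?_ (hs t ht)⟩
  exact CStarAlgebra.norm_le_norm_of_nonneg_of_le (Finset.sum_nonneg fun i _ => hf i)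
    (Finset.sum_le_sum fun i _ => hfg i)

variable (A) in
/-- The sequences `(aᵢ)` in `A` for which `∑ aᵢ aᵢ⋆` converges in norm. -/
def sqSummable : Submodule A (ℕ → A) where
  carrier := {f | Summable fun i => f i * star (f i)}
  zero_mem' := by simp
  add_mem' := by
    intro f g hf hg
    have hfg : Summable fun i => (2 : ℕ) • (f i * star (f i)) + (2 : ℕ) • (g i * star (g i)) := by
      simpa [two_smul] using (hf.add hf).add (hg.add hg)
    refine summable_of_nonneg_of_le (fun i => mul_star_self_nonneg _) (fun i => ?_) hfg
    rw [← sub_nonneg]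
    have h := mul_star_self_nonneg (f i - g i)
    convert h using 1
    simp only [Pi.add_apply, star_add, star_sub, two_smul]
    noncomm_ring
  smul_mem' := by
    intro a f hf
    have h := (Summable.mul_left a hf).mul_right (star a)
    refine h.congr fun i => ?_
    simp [mul_assoc]

variable (A) in
/-- The standard Hilbert `A`-module `H_A = ℓ²(A)`. This is a type synonym, because the topology of
`H_A` is not the product topology. -/
def StdModule : Type _ := sqSummable A

namespace StdModule

instance : AddCommGroup (StdModule A) := inferInstanceAs (AddCommGroup (sqSummable A))

instance : Module A (StdModule A) := inferInstanceAs (Module A (sqSummable A))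

noncomputable instance : Module ℂ (StdModule A) := inferInstanceAs (Module ℂ (sqSummable A))

/-- The `i`-th entry of an element of the standard module. -/
def coord (x : StdModule A) (i : ℕ) : A := x.1 i

theorem ext_coord {x y : StdModule A} (h : ∀ i, x.coord i = y.coord i) : x = y :=
  Subtype.ext (funext h)

theorem coord_add (x y : StdModule A) (i : ℕ) : (x + y).coord i = x.coord i + y.coord i := rfl

theorem coord_smul (a : A) (x : StdModule A) (i : ℕ) : (a • x).coord i = a * x.coord i := rfl

theorem coord_smul_complex (z : ℂ) (x : StdModule A) (i : ℕ) :
    (z • x).coord i = z • x.coord i := rfl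

theorem summable_self (x : StdModule A) : Summable fun i => x.coord i * star (x.coord i) := x.2

theorem summable_inner (x y : StdModule A) : Summable fun i => y.coord i * star (x.coord i) := by
  have h (c : ℂ) : Summable fun i => c • ((y + c • x).coord i * star ((y + c • x).coord i)) :=
    (summable_self (y + c • x)).const_smul c
  have hs := (((h 1).add (h (-1))).add ((h Complex.I).add (h (-Complex.I)))).const_smul (1 / 4 : ℂ)
  convert hs using 2 with i
  simp only [coord_add, coord_smul_complex, star_add, star_smul, add_mul, mul_add,
    smul_mul_assoc, mul_smul_comm, smul_add, smul_smul, RCLike.star_def, map_neg, map_one,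
    Complex.conj_I]
  ring_nf
  simp only [Complex.I_sq, Complex.I_pow_three]
  module

/-- The `A`-valued inner product `⟨x, y⟩ = ∑ yᵢ xᵢ⋆`. -/
noncomputable instance : Inner A (StdModule A) where
  inner x y := ∑' i, y.coord i * star (x.coord i)

theorem inner_def (x y : StdModule A) : ⟪x, y⟫_A = ∑' i, y.coord i * star (x.coord i) := rfl

/-- The norm `‖x‖ = ‖⟨x, x⟩‖ ^ (1/2)`. -/
noncomputable instance : Norm (StdModule A) := CStarModule.norm A

noncomputable instance : CStarModule A (StdModule A) where
  inner_add_right {x y z} := by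
    simp only [inner_def, coord_add, add_mul]
    exact (summable_inner x y).tsum_add (summable_inner x z)
  inner_self_nonneg := tsum_nonneg fun i => mul_star_self_nonneg _
  inner_self {x} := by
    refine ⟨fun h => ?_, fun h => by subst h; exact (tsum_congr fun i => zero_mul _).trans tsum_zero⟩
    have h0 : HasSum (fun i => x.coord i * star (x.coord i)) 0 := by
      rw [← h]; exact (summable_self x).hasSum
    have h1 := (hasSum_zero_iff_of_nonneg fun i => mul_star_self_nonneg (x.coord i)).mp h0
    exact ext_coord fun i => (CStarRing.mul_star_self_eq_zero_iff _).mp (congrFun h1 i)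
  inner_op_smul_right {a x y} := by
    simp only [inner_def, coord_smul, mul_assoc]
    exact (summable_inner x y).tsum_mul_left a
  inner_smul_right_complex {z x y} := by
    simp only [inner_def, coord_smul_complex, smul_mul_assoc]
    exact (summable_inner x y).tsum_const_smul z
  star_inner x y := by
    simp only [inner_def]
    rw [tsum_star]
    simp
  norm_eq_sqrt_norm_inner_self x := rfl

noncomputable instance : NormedAddCommGroup (StdModule A) :=
  NormedAddCommGroup.ofCore (CStarModule.normedSpaceCore A)

noncomputable instance : NormedSpace ℂ (StdModule A) :=
  NormedSpace.ofCore (CStarModule.normedSpaceCore A)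

end StdModule

end Standard

end HilbertModule

namespace HilbertModule

open scoped InnerProductSpace

/-! Both classes have a description that makes the lemma evident: `upperMinusPrime` consists of the
sums D + C with C of finite rank and D adjointable with a bounded `A`-linear left inverse, and
`lowerPlusPrime` of the same sums with right inverses. One-sided invertibility survives small
perturbations, and a compact operator is a small operator plus one of finite rank, so openness and
stability follow.

A decomposition of F amounts to a bounded `A`-linear B with BFB = B, where N₁ = ker BF and N₂ = ker
B. The relation ⪯ supplies a finite rank correction that makes F one-sidedly invertible
(`upperMinusPrime_subset`, `lowerPlusPrime_subset`). The correction is adjointable because a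
finitely generated closed submodule is the range of a finite rank idempotent
(`exists_finiteRank_projection`).

Conversely, coordinate projections T of ℓ²(A) approximate C by CT and by TC. The error is absorbed
into D, and the one-sided inverse, cut down by 1 - T, is the outer inverse B of a decomposition with
the required embedding. -/

/-- An `A`-linear map which is invertible as a bounded operator has a bounded `A`-linear
inverse. -/
theorem exists_inverse_of_isUnit {A N : Type*} [Ring A] [NormedAddCommGroup N] [NormedSpace ℂ N]
    [Module A N] (V : N →L[ℂ] N) (hV : ∀ (a : A) (x : N), V (a • x) = a • V x) (h : IsUnit V) :
    ∃ W : N →L[A] N, (∀ x, V (W x) = x) ∧ ∀ x, W (V x) = x := by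
  obtain ⟨U, rfl⟩ := h
  have h₁ (x : N) : (U : N →L[ℂ] N) ((↑U⁻¹ : N →L[ℂ] N) x) = x :=
    congrArg (fun f : N →L[ℂ] N => f x) U.mul_inv
  have h₂ (x : N) : (↑U⁻¹ : N →L[ℂ] N) ((U : N →L[ℂ] N) x) = x :=
    congrArg (fun f : N →L[ℂ] N => f x) U.inv_mul
  refine ⟨⟨⟨⟨(↑U⁻¹ : N →L[ℂ] N), map_add _⟩, fun a x => ?_⟩, (↑U⁻¹ : N →L[ℂ] N).continuous⟩, h₁, h₂⟩
  change (↑U⁻¹ : N →L[ℂ] N) (a • x) = a • (↑U⁻¹ : N →L[ℂ] N) x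
  conv_lhs => rw [← h₁ x, ← hV, h₂]

/-! ### Bounded idempotents and direct sums -/

section Idempotent

variable {A E : Type*} [Ring A] [NormedAddCommGroup E] [Module A E]

theorem mem_range_iff_of_idempotent {p : E →L[A] E} (hp : p * p = p) {x : E} :
    x ∈ LinearMap.range (p : E →ₗ[A] E) ↔ p x = x := by
  constructor
  · rintro ⟨y, rfl⟩
    exact congrArg (fun f : E →L[A] E => f y) hp
  · exact fun h => ⟨x, h⟩

theorem isClosed_range_of_idempotent {p : E →L[A] E} (hp : p * p = p) :
    IsClosed (LinearMap.range (p : E →ₗ[A] E) : Set E) := by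
  have : (LinearMap.range (p : E →ₗ[A] E) : Set E) = {x | p x = x} :=
    Set.ext fun x => mem_range_iff_of_idempotent hp
  rw [this]
  exact isClosed_eq p.continuous continuous_id

theorem isClosed_ker (p : E →L[A] E) : IsClosed (LinearMap.ker (p : E →ₗ[A] E) : Set E) :=
  isClosed_singleton.preimage p.continuous

theorem isCompl_of_idempotent {p : E →L[A] E} (hp : p * p = p) :
    IsCompl (LinearMap.range (p : E →ₗ[A] E)) (LinearMap.ker (p : E →ₗ[A] E)) := by
  refine IsCompl.of_eq ?_ ?_
  · rw [Submodule.eq_bot_iff]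
    rintro x ⟨h₁, h₂⟩
    rw [← (mem_range_iff_of_idempotent hp).mp h₁]
    exact h₂
  · rw [Submodule.eq_top_iff']
    intro x
    rw [← add_sub_cancel (p x) x]
    refine Submodule.add_mem_sup ⟨x, rfl⟩ ?_
    have h : p (p x) = p x := congrArg (fun f : E →L[A] E => f x) hp
    change p (x - p x) = 0
    rw [map_sub, h, sub_self]

/-- The range of 1 - p lies in ker p, which q fixes. It is applied with p = BF or FB and q a
projection onto N₁ or N₂. -/
theorem one_sub_mul_one_sub_eq_zero {q p : E →L[A] E} (hp : p * p = p)
    (hq : ∀ z ∈ LinearMap.ker p.toLinearMap, q z = z) : (1 - q) * (1 - p) = 0 := by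
  ext z
  have : p (z - p z) = 0 := by
    rw [map_sub, sub_eq_zero]
    exact (congrArg (fun f : E →L[A] E => f z) hp).symm
  exact sub_eq_zero.mpr (hq _ this).symm

end Idempotent

/-! ### Bounded `A`-linear maps and small perturbations -/

section BoundedMaps

variable {A E : Type*} [CStarAlgebra A] [PartialOrder A] [StarOrderedRing A]
  [NormedAddCommGroup E] [NormedSpace ℂ E] [Module A E] [CStarModule A E]

/-- Allows restriction of scalars to ℂ, where the Banach space theorems apply. -/
instance isScalarTower_complex : IsScalarTower ℂ A E := ⟨smul_complex_smul⟩

/-- An adjointable operator as a bounded `A`-linear map. -/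
def toCLM (T : adjointable A E) : E →L[A] E where
  toFun := (T : E →L[ℂ] E)
  map_add' := map_add _
  map_smul' := adjointable_map_smul T
  cont := (T : E →L[ℂ] E).continuous

@[simp] theorem toCLM_apply (T : adjointable A E) (x : E) : toCLM T x = (T : E →L[ℂ] E) x := rfl

theorem toCLM_mul (S T : adjointable A E) : toCLM (S * T) = toCLM S * toCLM T := rfl

theorem toCLM_add (S T : adjointable A E) : toCLM (S + T) = toCLM S + toCLM T := rfl

theorem toCLM_sub (S T : adjointable A E) : toCLM (S - T) = toCLM S - toCLM T := rfl

theorem isUnit_of_isUnit_restrictScalars (V : E →L[A] E) (h : IsUnit (V.restrictScalars ℂ)) :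
    IsUnit V := by
  obtain ⟨W, h₁, h₂⟩ := exists_inverse_of_isUnit (A := A) (V.restrictScalars ℂ) (map_smul V) h
  exact ⟨⟨V, W, ContinuousLinearMap.ext h₁, ContinuousLinearMap.ext h₂⟩, rfl⟩

/-- Left and right invertibility in the bounded `A`-linear maps are stable under small adjointable
perturbations. -/
theorem exists_isUnit_one_add [CompleteSpace E] (J : E →L[A] E) :
    ∃ ε > 0, ∀ T : adjointable A E, ‖T‖ < ε →
      IsUnit (1 + J * toCLM T) ∧ IsUnit (1 + toCLM T * J) := by
  set J' : E →L[ℂ] E := J.restrictScalars ℂ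
  have hpos : 0 < ‖J'‖ + 1 := by positivity
  -- Neumann series; the added 1 keeps the radius meaningful for J = 0.
  refine ⟨(‖J'‖ + 1)⁻¹, inv_pos.mpr hpos, fun T hT => ?_⟩
  have hT' : ‖(T : E →L[ℂ] E)‖ * (‖J'‖ + 1) < 1 := by
    rwa [← lt_div_iff₀ hpos, one_div]
  have hT0 := norm_nonneg (T : E →L[ℂ] E)
  have unit (X : E →L[ℂ] E) (hX : ‖X‖ < 1) : IsUnit (1 + X) := by
    have := isUnit_one_sub_of_norm_lt_one (x := -X) (by rwa [norm_neg])
    rwa [sub_neg_eq_add] at this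
  constructor
  · refine isUnit_of_isUnit_restrictScalars _ (unit (J' * (T : E →L[ℂ] E)) ?_)
    refine (norm_mul_le _ _).trans_lt ?_
    nlinarith
  · refine isUnit_of_isUnit_restrictScalars _ (unit ((T : E →L[ℂ] E) * J') ?_)
    refine (norm_mul_le _ _).trans_lt ?_
    nlinarith

end BoundedMaps

/-! ### Decompositions and outer inverses -/

section Decomposition

variable {A E : Type*} [CStarAlgebra A] [PartialOrder A] [StarOrderedRing A]
  [NormedAddCommGroup E] [NormedSpace ℂ E] [Module A E] [CStarModule A E]

/-- A bounded `A`-linear outer inverse `B` of `F` yields a decomposition of `F`. -/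
theorem isDecomposition_of_outer_inverse (F : adjointable A E) (B : E →L[A] E)
    (hB : B * toCLM F * B = B) :
    IsDecomposition F (LinearMap.range (B * toCLM F : E →L[A] E).toLinearMap)
      (LinearMap.ker (B * toCLM F : E →L[A] E).toLinearMap)
      (LinearMap.range (toCLM F * B : E →L[A] E).toLinearMap)
      (LinearMap.ker B.toLinearMap) := by
  have h₁ : B * toCLM F * (B * toCLM F) = B * toCLM F := by rw [← mul_assoc, hB]
  have h₂ : toCLM F * B * (toCLM F * B) = toCLM F * B := by
    rw [mul_assoc, ← mul_assoc B, hB]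
  -- Since B = BFB, the kernel of B is that of the idempotent FB, hence a complement of its range.
  have hker : LinearMap.ker B.toLinearMap = LinearMap.ker (toCLM F * B : E →L[A] E).toLinearMap := by
    ext x
    change B x = 0 ↔ toCLM F (B x) = 0
    refine ⟨fun h => by rw [h, map_zero], fun h => ?_⟩
    rw [← hB]
    change B (toCLM F (B x)) = 0
    rw [h, map_zero]
  refine ⟨isClosed_range_of_idempotent h₁, isClosed_ker _, isClosed_range_of_idempotent h₂,
    isClosed_ker _, isCompl_of_idempotent h₁, hker ▸ isCompl_of_idempotent h₂, ?_, fun x hx => hx⟩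
  have e₁ (x : LinearMap.range (B * toCLM F : E →L[A] E).toLinearMap) : B (toCLM F x) = x :=
    (mem_range_iff_of_idempotent h₁).mp x.2
  have e₂ (x : LinearMap.range (toCLM F * B : E →L[A] E).toLinearMap) : toCLM F (B x) = x :=
    (mem_range_iff_of_idempotent h₂).mp x.2
  refine ⟨ContinuousLinearEquiv.equivOfInverse
    (((toCLM F).comp (Submodule.subtypeL _)).codRestrict _ fun x => ⟨toCLM F x, ?_⟩)
    ((B.comp (Submodule.subtypeL _)).codRestrict _ fun x => ⟨B x, ?_⟩)
    (fun x => Subtype.ext (e₁ x)) (fun x => Subtype.ext (e₂ x)), fun x => rfl⟩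
  · exact congrArg (toCLM F) (e₁ x)
  · exact congrArg B (e₂ x)

/-- The projection along a closed complement is bounded. -/
theorem continuous_projection_of_isClosed [CompleteSpace E] {M N : Submodule A E}
    (hM : IsClosed (M : Set E)) (hN : IsClosed (N : Set E)) (h : IsCompl M N) :
    Continuous (M.projection N h) := by
  -- Closed graph theorem: y is the projection of x exactly when y ∈ M and x - y ∈ N, both closed
  -- conditions.
  refine LinearMap.continuous_of_isClosed_graph ((M.projection N h).restrictScalars ℂ) ?_
  have : (((M.projection N h).restrictScalars ℂ).graph : Set (E × E)) =
      {x | x.2 ∈ M} ∩ {x | x.1 - x.2 ∈ N} := by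
    ext ⟨x, y⟩
    simp only [SetLike.mem_coe, LinearMap.mem_graph_iff, LinearMap.restrictScalars_apply,
      Set.mem_inter_iff, Set.mem_ofPred_eq]
    constructor
    · rintro rfl
      refine ⟨Submodule.projection_apply_mem h x, ?_⟩
      rw [← Submodule.projection_apply_eq_zero_iff h, map_sub, sub_eq_zero]
      exact (Submodule.projection_apply_left h ⟨_, Submodule.projection_apply_mem h x⟩).symm
    · rintro ⟨h₁, h₂⟩
      rw [← Submodule.projection_apply_eq_zero_iff h, map_sub, sub_eq_zero] at h₂
      rw [h₂]
      exact (Submodule.projection_apply_left h ⟨y, h₁⟩).symm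
  rw [this]
  exact (hM.preimage continuous_snd).inter (hN.preimage (continuous_fst.sub continuous_snd))

/-- Every decomposition of `F` comes from a bounded `A`-linear outer inverse of `F`. -/
theorem IsDecomposition.exists_outer_inverse [CompleteSpace E] {F : adjointable A E}
    {M₁ N₁ M₂ N₂ : Submodule A E} (h : IsDecomposition F M₁ N₁ M₂ N₂) :
    ∃ B : E →L[A] E, B * toCLM F * B = B ∧
      N₁ = LinearMap.ker (B * toCLM F : E →L[A] E).toLinearMap ∧
      N₂ = LinearMap.ker B.toLinearMap := by
  obtain ⟨F₁, hF₁⟩ := h.iso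
  have hc := continuous_projection_of_isClosed h.closed_M₂ h.closed_N₂ h.isCompl_codomain
  let p : E →L[A] M₂ := ⟨M₂.projectionOnto N₂ h.isCompl_codomain, hc.subtype_mk _⟩
  have hp (x : M₂) : p x = x := Submodule.projectionOnto_apply_left h.isCompl_codomain x
  have hp0 (x : E) : p x = 0 ↔ x ∈ N₂ := Submodule.projectionOnto_apply_eq_zero_iff _
  -- B is the inverse of F₁ on M₂ and zero on N₂.
  let B : E →L[A] E := (M₁.subtypeL.comp (F₁.symm : M₂ →L[A] M₁)).comp p
  have hB (x : E) : B x = F₁.symm (p x) := rfl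
  have hB0 (x : E) : B x = 0 ↔ x ∈ N₂ := by
    rw [hB, ZeroMemClass.coe_eq_zero, map_eq_zero_iff _ F₁.symm.injective, hp0]
  have hBF (x : M₁) : B (toCLM F x) = x := by
    rw [toCLM_apply, ← hF₁, hB, hp, F₁.symm_apply_apply]
  refine ⟨B, ?_, ?_, ?_⟩
  · ext x
    exact hBF (F₁.symm (p x))
  · ext x
    change x ∈ N₁ ↔ B (toCLM F x) = 0
    refine ⟨fun hx => (hB0 _).mpr (h.mapsTo x hx), fun hx => ?_⟩
    obtain ⟨m, hm, n, hn, rfl⟩ := Submodule.mem_sup.mp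
      (h.isCompl_domain.sup_eq_top ▸ Submodule.mem_top : x ∈ M₁ ⊔ N₁)
    have h₁ : B (toCLM F n) = 0 := (hB0 _).mpr (h.mapsTo n hn)
    rw [map_add, map_add, h₁, add_zero, hBF ⟨m, hm⟩] at hx
    rw [show m = 0 from hx, zero_add]
    exact hn
  · ext x
    exact (hB0 x).symm

end Decomposition

/-- A bounded `A`-linear map with a left inverse on a closed submodule embeds it. -/
theorem preceq_of_leftInverse {A E : Type*} [CStarAlgebra A] [NormedAddCommGroup E] [Module A E]
    {N N' : Submodule A E} (hN : IsClosed (N : Set E)) (f g : E →L[A] E)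
    (hf : ∀ x ∈ N, f x ∈ N') (hg : ∀ x ∈ N, g (f x) = x) : Preceq N N' := by
  -- Describes the image by conditions that are closed in y.
  have hmem {y : E} : y ∈ N.map f.toLinearMap ↔ g y ∈ N ∧ f (g y) = y := by
    constructor
    · rintro ⟨x, hx, rfl⟩
      change g (f x) ∈ N ∧ f (g (f x)) = f x
      rw [hg x hx]
      exact ⟨hx, rfl⟩
    · rintro ⟨h₁, h₂⟩
      exact ⟨g y, h₁, h₂⟩
  refine ⟨N.map f.toLinearMap, ?_, ?_, ⟨ContinuousLinearEquiv.equivOfInverse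
    ((f.comp N.subtypeL).codRestrict _ fun x => ⟨x, x.2, rfl⟩)
    ((g.comp (Submodule.subtypeL _)).codRestrict N fun y => (hmem.mp y.2).1)
    (fun x => Subtype.ext (hg x x.2)) (fun y => Subtype.ext (hmem.mp y.2).2)⟩⟩
  · rintro _ ⟨x, hx, rfl⟩
    exact hf x hx
  · have : (N.map f.toLinearMap : Set E) = {y | g y ∈ N} ∩ {y | f (g y) = y} :=
      Set.ext fun y => hmem
    rw [this]
    exact (hN.preimage g.continuous).inter
      (isClosed_eq (f.continuous.comp g.continuous) continuous_id)

/-- If `S + t` is bounded below, uniformly in `t ≥ 0`, then `S` is invertible. -/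
theorem isUnit_of_forall_norm_le {X : Type*} [NormedAddCommGroup X] [NormedSpace ℂ X]
    [CompleteSpace X] (S : X →L[ℂ] X) {K : ℝ} (hK : 0 < K)
    (h : ∀ t : ℝ, 0 ≤ t → ∀ z, ‖z‖ ≤ K * ‖S z + (t : ℂ) • z‖) : IsUnit S := by
  let φ (t : ℝ) : X →L[ℂ] X := S + (t : ℂ) • 1
  -- Continuation in t: the lower bound gives ‖(S + t)⁻¹‖ ≤ K wherever the inverse exists, so
  -- invertibility passes to every t' within distance less than 1/K. Steps of length 1/(2K) lead
  -- from a large t, outside the spectral radius, down to 0.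
  have step (t t' : ℝ) (ht : 0 ≤ t) (hd : ‖t' - t‖ * K < 1) (hu : IsUnit (φ t)) :
      IsUnit (φ t') := by
    obtain ⟨u, hu⟩ := hu
    have hinv : ‖(↑u⁻¹ : X →L[ℂ] X)‖ ≤ K := by
      refine ContinuousLinearMap.opNorm_le_bound _ hK.le fun z => (h t ht _).trans_eq ?_
      have : φ t ((↑u⁻¹ : X →L[ℂ] X) z) = z := by
        rw [← hu]
        exact congrArg (fun f : X →L[ℂ] X => f z) u.mul_inv
      exact congrArg (fun w => K * ‖w‖) this
    have hprod : IsUnit (1 + (↑u⁻¹ : X →L[ℂ] X) * (((t' - t : ℝ) : ℂ) • 1)) := by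
      rw [← sub_neg_eq_add]
      refine isUnit_one_sub_of_norm_lt_one ?_
      rw [norm_neg, mul_smul_comm, mul_one, norm_smul, Complex.norm_real]
      exact (mul_le_mul_of_nonneg_left hinv (norm_nonneg _)).trans_lt hd
    have := u.isUnit.mul hprod
    rw [mul_add, mul_one, ← mul_assoc, u.mul_inv, one_mul, hu] at this
    convert this using 1
    simp only [φ]
    push_cast
    module
  obtain ⟨n, hn⟩ := exists_nat_gt ((‖S‖ * ‖(1 : X →L[ℂ] X)‖ + 1) * (2 * K))
  have hd : (0 : ℝ) < 1 / (2 * K) := by positivity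
  have start : IsUnit (φ (n * (1 / (2 * K)))) := by
    have hlt : ‖S‖ * ‖(1 : X →L[ℂ] X)‖ < ‖(-(n * (1 / (2 * K)) : ℝ) : ℂ)‖ := by
      rw [norm_neg, Complex.norm_real, Real.norm_of_nonneg (by positivity), mul_one_div,
        lt_div_iff₀ (by positivity)]
      refine lt_of_le_of_lt ?_ hn
      gcongr
      linarith
    have := (spectrum.mem_resolventSet_iff.mp (spectrum.mem_resolventSet_of_norm_lt_mul hlt)).neg
    convert this using 1
    simp only [φ, Algebra.algebraMap_eq_smul_one]
    module
  have down (k : ℕ) : IsUnit (φ (k * (1 / (2 * K)))) → IsUnit (φ 0) := by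
    induction k with
    | zero => simp
    | succ k ih =>
      refine fun hu => ih (step _ _ (by positivity) ?_ hu)
      rw [show (k : ℝ) * (1 / (2 * K)) - ((k + 1 : ℕ) : ℝ) * (1 / (2 * K)) = -(1 / (2 * K)) by
        push_cast; ring, norm_neg, Real.norm_of_nonneg hd.le]
      field_simp
      norm_num
  simpa [φ] using down n start

/-! ### Finite rank operators and finitely generated submodules -/

section FiniteRank

variable {A E : Type*} [CStarAlgebra A] [PartialOrder A] [StarOrderedRing A]
  [NormedAddCommGroup E] [NormedSpace ℂ E] [Module A E] [CStarModule A E]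

variable (A E) in
/-- The linear span of the elementary operators `θ_{x,y}`. -/
def finiteRank : Submodule ℂ (adjointable A E) :=
  Submodule.span ℂ (Set.range fun p : E × E => (rankOne p.1 p.2 : adjointable A E))

theorem rankOne_apply (x y z : E) :
    ((rankOne x y : adjointable A E) : E →L[ℂ] E) z = ⟪y, z⟫_A • x := rfl

theorem rankOne_mem_finiteRank (x y : E) : rankOne x y ∈ finiteRank A E :=
  Submodule.subset_span ⟨(x, y), rfl⟩

theorem mul_mem_finiteRank (F : adjointable A E) {C : adjointable A E} (hC : C ∈ finiteRank A E) :
    F * C ∈ finiteRank A E := by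
  induction hC using Submodule.span_induction with
  | mem C hC =>
    obtain ⟨⟨x, y⟩, rfl⟩ := hC
    convert rankOne_mem_finiteRank (A := A) ((F : E →L[ℂ] E) x) y
    ext z
    exact adjointable_map_smul F _ _
  | zero => simp
  | add C C' _ _ h h' => rw [mul_add]; exact add_mem h h'
  | smul c C _ h => rw [mul_smul_comm]; exact Submodule.smul_mem _ c h

theorem finiteRank_mul_mem (F : adjointable A E) {C : adjointable A E} (hC : C ∈ finiteRank A E) :
    C * F ∈ finiteRank A E := by
  obtain ⟨S, hS⟩ := F.2
  induction hC using Submodule.span_induction with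
  | mem C hC =>
    obtain ⟨⟨x, y⟩, rfl⟩ := hC
    convert rankOne_mem_finiteRank (A := A) x (S y)
    ext z
    have : ⟪y, (F : E →L[ℂ] E) z⟫_A = ⟪S y, z⟫_A := by
      rw [← CStarModule.star_inner (A := A) ((F : E →L[ℂ] E) z) y, hS, CStarModule.star_inner]
    exact congrArg (· • x) this
  | zero => simp
  | add C C' _ _ h h' => rw [add_mul]; exact add_mem h h'
  | smul c C _ h => rw [smul_mul_assoc]; exact Submodule.smul_mem _ c h

theorem norm_sq_le_of_inner_sum {n : ℕ} (b : Fin n → A) (i : Fin n) :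
    ‖b i‖ ^ 2 ≤ ‖∑ j, b j * star (b j)‖ := by
  rw [sq, ← CStarRing.norm_self_mul_star]
  exact CStarAlgebra.norm_le_norm_of_nonneg_of_le (mul_star_self_nonneg _)
    (Finset.single_le_sum (f := fun j => b j * star (b j)) (fun j _ => mul_star_self_nonneg _)
      (Finset.mem_univ i))

/-- The norm on a finitely generated closed submodule is dominated by the frame coefficients with
respect to a finite generating family. -/
theorem exists_norm_sq_le_frame [CompleteSpace E] {N : Submodule A E} (hN : IsClosed (N : Set E))
    {n : ℕ} {x : Fin n → E} (hx : Submodule.span A (Set.range x) = N) :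
    ∃ K > 0, ∀ z ∈ N, ‖z‖ ^ 2 ≤ K * ‖∑ i, ⟪x i, z⟫_A * star ⟪x i, z⟫_A‖ := by
  have hxN (i : Fin n) : x i ∈ N := hx ▸ Submodule.subset_span ⟨i, rfl⟩
  have : CompleteSpace N := hN.completeSpace_coe
  let T₀ : (Fin n → A) →ₗ[ℂ] N :=
    { toFun := fun a => ∑ i, a i • (⟨x i, hxN i⟩ : N)
      map_add' := fun a b => by
        simp only [Pi.add_apply, add_smul, Finset.sum_add_distrib]
      map_smul' := fun c a => by simp [Finset.smul_sum] }
  have hT₀ (a : Fin n → A) : (T₀ a : E) = ∑ i, a i • x i := by simp [T₀]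
  let T : (Fin n → A) →L[ℂ] N := T₀.mkContinuous (∑ i, ‖x i‖) fun a => by
    rw [Submodule.coe_norm, hT₀, Finset.sum_mul]
    refine (norm_sum_le _ _).trans (Finset.sum_le_sum fun i _ => ?_)
    refine (norm_smul_le_mul (A := A) _ _).trans ?_
    rw [mul_comm]
    gcongr
    exact norm_le_pi_norm a i
  have hsurj : Function.Surjective T := by
    rintro ⟨z, hz⟩
    rw [← hx, Submodule.mem_span_range_iff_exists_fun] at hz
    obtain ⟨a, rfl⟩ := hz
    exact ⟨a, Subtype.ext (hT₀ a)⟩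
  -- Open mapping theorem for Aⁿ → N: every z is ∑ aᵢxᵢ with ‖a‖ ≤ C‖z‖. Expanding one argument of
  -- ⟨z, z⟩ bounds ‖z‖ by the frame coefficients.
  obtain ⟨C, hC, hpre⟩ := T.exists_preimage_norm_le hsurj
  -- The added 1 keeps K positive when n = 0.
  refine ⟨(n * C) ^ 2 + 1, by positivity, fun z hz => ?_⟩
  obtain ⟨a, ha, hle⟩ := hpre ⟨z, hz⟩
  have haz : ∑ i, a i • x i = z := by rw [← hT₀]; exact congrArg Subtype.val ha
  have hle' : ‖a‖ ≤ C * ‖z‖ := hle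
  set R := ‖∑ i, ⟪x i, z⟫_A * star ⟪x i, z⟫_A‖
  have hb (i : Fin n) : ‖⟪x i, z⟫_A‖ ≤ √R :=
    Real.le_sqrt_of_sq_le (norm_sq_le_of_inner_sum (fun i => ⟪x i, z⟫_A) i)
  have h₁ : ‖z‖ ^ 2 ≤ n * C * √R * ‖z‖ := by
    calc ‖z‖ ^ 2 = ‖∑ i, ⟪x i, z⟫_A * star (a i)‖ := by
          rw [CStarModule.norm_sq_eq A (x := z)]
          conv_lhs => rw [← haz, CStarModule.inner_sum_left]
          simp_rw [CStarModule.inner_op_smul_left, haz]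
      _ ≤ ∑ _i : Fin n, √R * (C * ‖z‖) := by
          refine (norm_sum_le _ _).trans (Finset.sum_le_sum fun i _ => (norm_mul_le _ _).trans ?_)
          rw [norm_star]
          exact mul_le_mul (hb i) ((norm_le_pi_norm a i).trans hle') (norm_nonneg _)
            (Real.sqrt_nonneg _)
      _ = n * C * √R * ‖z‖ := by
          rw [Finset.sum_const, Finset.card_univ, Fintype.card_fin, nsmul_eq_mul]; ring
  have h₂ : ‖z‖ ≤ n * C * √R := by
    rcases (norm_nonneg z).eq_or_lt with h | h
    · rw [← h]; positivity
    · rw [sq] at h₁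
      exact le_of_mul_le_mul_right h₁ h
  calc ‖z‖ ^ 2 ≤ (n * C * √R) ^ 2 := by gcongr
    _ = (n * C) ^ 2 * R := by rw [mul_pow, Real.sq_sqrt (norm_nonneg _)]
    _ ≤ _ := by gcongr; linarith

/-- A finitely generated closed submodule is the range of a bounded idempotent of finite rank. -/
theorem exists_finiteRank_projection [CompleteSpace E] {N : Submodule A E}
    (hN : IsClosed (N : Set E)) (hfg : N.FG) :
    ∃ Q : E →L[A] N, (∀ z : N, Q z = z) ∧
      ∀ φ : N →L[A] E, ∃ C ∈ finiteRank A E, toCLM C = φ.comp Q := by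
  obtain ⟨n, x, hx⟩ := Submodule.fg_iff_exists_fin_generating_family.mp hfg
  have hxN (i : Fin n) : x i ∈ N := hx ▸ Submodule.subset_span ⟨i, rfl⟩
  have : CompleteSpace N := hN.completeSpace_coe
  obtain ⟨K, hK, hbound⟩ := exists_norm_sq_le_frame hN hx
  let S : E →L[A] N := (∑ i, toCLM (rankOne (x i) (x i))).codRestrict N fun z => by
    rw [sum_apply]
    exact sum_mem fun i _ => N.smul_mem _ (hxN i)
  have hS (z : E) : (S z : E) = ∑ i, ⟪x i, z⟫_A • x i := by
    simp [S, rankOne_apply]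
  let SN : N →L[A] N := S.comp N.subtypeL
  -- ⟨z, (S + t)z⟩ is the frame sum plus t⟨z, z⟩, so it dominates the frame sum for t ≥ 0. The frame
  -- bound and Cauchy–Schwarz then bound S + t below on N, uniformly in t.
  have hunit : IsUnit (SN.restrictScalars ℂ) := by
    refine isUnit_of_forall_norm_le _ hK fun t ht z => ?_
    have hSz : ⟪(z : E), (S z : E)⟫_A = ∑ i, ⟪x i, (z : E)⟫_A * star ⟪x i, (z : E)⟫_A := by
      rw [hS, CStarModule.inner_sum_right]
      simp
    have h₁ : ‖z‖ ^ 2 ≤ K * (‖z‖ * ‖SN z + (t : ℂ) • z‖) := by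
      refine (hbound z z.2).trans ?_
      gcongr
      refine le_trans ?_ (CStarModule.norm_inner_le (A := A) E
        (x := (z : E)) (y := (SN z + (t : ℂ) • z : N)))
      have he : ⟪(z : E), ((SN z + (t : ℂ) • z : N) : E)⟫_A =
          (∑ i, ⟪x i, (z : E)⟫_A * star ⟪x i, (z : E)⟫_A) + t • ⟪(z : E), (z : E)⟫_A := by
        rw [← hSz, Submodule.coe_add, show (((t : ℂ) • z : N) : E) = (t : ℂ) • (z : E) from rfl,
          CStarModule.inner_add_right, CStarModule.inner_smul_right_complex, Complex.coe_smul]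
        rfl
      rw [he]
      exact CStarAlgebra.norm_le_norm_of_nonneg_of_le
        (Finset.sum_nonneg fun i _ => mul_star_self_nonneg _)
        (le_add_of_nonneg_right (smul_nonneg ht CStarModule.inner_self_nonneg))
    rcases (norm_nonneg z).eq_or_lt with h | h
    · rw [← h]; positivity
    · refine le_of_mul_le_mul_right ?_ h
      rw [sq] at h₁
      calc _ ≤ _ := h₁
        _ = _ := by
          change _ = K * ‖SN z + (t : ℂ) • z‖ * ‖z‖
          ring
  obtain ⟨G, -, hG⟩ := exists_inverse_of_isUnit (A := A) (SN.restrictScalars ℂ) (map_smul SN) hunit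
  -- Q = (S|N)⁻¹S. As S is a sum of θ_{xᵢ,xᵢ}, φQ is the sum of θ_{φ(Gxᵢ),xᵢ}, adjointable even if φ
  -- is only bounded and `A`-linear.
  refine ⟨G.comp S, hG, fun φ => ⟨∑ i, rankOne (φ (G ⟨x i, hxN i⟩)) (x i),
    sum_mem fun i _ => rankOne_mem_finiteRank _ _, ?_⟩⟩
  ext z
  have : S z = ∑ i, ⟪x i, z⟫_A • (⟨x i, hxN i⟩ : N) := Subtype.ext (by rw [hS]; simp)
  change _ = φ (G (S z))
  rw [this, map_sum, map_sum]
  simp only [map_smul]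
  simp [rankOne_apply]

end FiniteRank

/-! ### Both classes as finite rank perturbations of one-sidedly invertible operators -/

section Characterization

variable {A E : Type*} [CStarAlgebra A] [PartialOrder A] [StarOrderedRing A]
  [NormedAddCommGroup E] [NormedSpace ℂ E] [Module A E] [CStarModule A E]

variable (A E) in
/-- The finite rank perturbations of adjointable operators which have a bounded `A`-linear left
inverse. -/
def leftInvertibleAddFiniteRank : Set (adjointable A E) :=
  {F | ∃ D : adjointable A E, ∃ C ∈ finiteRank A E, F = D + C ∧
    ∃ J : E →L[A] E, J * toCLM D = 1}

variable (A E) in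
/-- The finite rank perturbations of adjointable operators which have a bounded `A`-linear right
inverse. -/
def rightInvertibleAddFiniteRank : Set (adjointable A E) :=
  {F | ∃ D : adjointable A E, ∃ C ∈ finiteRank A E, F = D + C ∧
    ∃ R : E →L[A] E, toCLM D * R = 1}

variable (A E) in
/-- Operators of finite rank are approximated by their compressions to finitely generated ranges
of adjointable idempotents. -/
def HasFiniteRankApproximation : Prop :=
  ∀ C ∈ finiteRank A E, ∀ ε > 0, ∃ T : adjointable A E, T * T = T ∧
    (LinearMap.range (toCLM T).toLinearMap).FG ∧ ‖C - C * T‖ < ε ∧ ‖C - T * C‖ < ε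

theorem exists_left_inverse_add [CompleteSpace E] {D : adjointable A E} {J : E →L[A] E}
    (hJ : J * toCLM D = 1) :
    ∃ ε > 0, ∀ T : adjointable A E, ‖T‖ < ε → ∃ J' : E →L[A] E, J' * toCLM (D + T) = 1 := by
  obtain ⟨ε, hε, h⟩ := exists_isUnit_one_add J
  refine ⟨ε, hε, fun T hT => ?_⟩
  obtain ⟨u, hu⟩ := (h T hT).1
  exact ⟨↑u⁻¹ * J, by rw [mul_assoc, toCLM_add, mul_add, hJ, ← hu, u.inv_mul]⟩

theorem exists_right_inverse_add [CompleteSpace E] {D : adjointable A E} {R : E →L[A] E}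
    (hR : toCLM D * R = 1) :
    ∃ ε > 0, ∀ T : adjointable A E, ‖T‖ < ε → ∃ R' : E →L[A] E, toCLM (D + T) * R' = 1 := by
  obtain ⟨ε, hε, h⟩ := exists_isUnit_one_add R
  refine ⟨ε, hε, fun T hT => ?_⟩
  obtain ⟨u, hu⟩ := (h T hT).2
  exact ⟨R * ↑u⁻¹, by rw [← mul_assoc, toCLM_add, add_mul, hR, ← hu, u.mul_inv]⟩

/-- The difference G - F is absorbed into D while C stays fixed. -/
theorem isOpen_leftInvertibleAddFiniteRank [CompleteSpace E] :
    IsOpen (leftInvertibleAddFiniteRank A E) := by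
  rw [Metric.isOpen_iff]
  rintro F ⟨D, C, hC, rfl, J, hJ⟩
  obtain ⟨ε, hε, h⟩ := exists_left_inverse_add hJ
  refine ⟨ε, hε, fun G hG => ⟨D + (G - (D + C)), C, hC, by abel, h _ ?_⟩⟩
  rwa [Metric.mem_ball, dist_eq_norm] at hG

theorem isOpen_rightInvertibleAddFiniteRank [CompleteSpace E] :
    IsOpen (rightInvertibleAddFiniteRank A E) := by
  rw [Metric.isOpen_iff]
  rintro F ⟨D, C, hC, rfl, R, hR⟩
  obtain ⟨ε, hε, h⟩ := exists_right_inverse_add hR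
  refine ⟨ε, hε, fun G hG => ⟨D + (G - (D + C)), C, hC, by abel, h _ ?_⟩⟩
  rwa [Metric.mem_ball, dist_eq_norm] at hG

theorem exists_finiteRank_norm_sub_lt {K : adjointable A E} (hK : K ∈ compactOperators A E)
    {ε : ℝ} (hε : 0 < ε) : ∃ C ∈ finiteRank A E, ‖K - C‖ < ε := by
  obtain ⟨C, hC, h⟩ := Metric.mem_closure_iff.mp hK ε hε
  exact ⟨C, hC, by rwa [dist_eq_norm] at h⟩

theorem add_compact_mem_leftInvertibleAddFiniteRank [CompleteSpace E] {F K : adjointable A E}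
    (hF : F ∈ leftInvertibleAddFiniteRank A E) (hK : K ∈ compactOperators A E) :
    F + K ∈ leftInvertibleAddFiniteRank A E := by
  obtain ⟨D, C, hC, rfl, J, hJ⟩ := hF
  obtain ⟨ε, hε, h⟩ := exists_left_inverse_add hJ
  obtain ⟨C', hC', hlt⟩ := exists_finiteRank_norm_sub_lt hK hε
  exact ⟨D + (K - C'), C + C', add_mem hC hC', by abel, h _ hlt⟩

theorem add_compact_mem_rightInvertibleAddFiniteRank [CompleteSpace E] {F K : adjointable A E}
    (hF : F ∈ rightInvertibleAddFiniteRank A E) (hK : K ∈ compactOperators A E) :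
    F + K ∈ rightInvertibleAddFiniteRank A E := by
  obtain ⟨D, C, hC, rfl, R, hR⟩ := hF
  obtain ⟨ε, hε, h⟩ := exists_right_inverse_add hR
  obtain ⟨C', hC', hlt⟩ := exists_finiteRank_norm_sub_lt hK hε
  exact ⟨D + (K - C'), C + C', add_mem hC hC', by abel, h _ hlt⟩

/-- A finitely generated closed submodule `N` with `N ⪯ N'` is the range of a finite rank idempotent
`q` which factors through `N'` by operators of finite rank. -/
theorem Preceq.exists_factorization [CompleteSpace E] {N N' : Submodule A E}
    (h : Preceq N N') (hN : IsClosed (N : Set E)) (hfg : N.FG) :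
    ∃ q ∈ finiteRank A E, ∃ i ∈ finiteRank A E, ∃ l ∈ finiteRank A E,
      (∀ z ∈ N, toCLM q z = z) ∧ (∀ z, toCLM q z ∈ N) ∧ (∀ z, toCLM i z ∈ N') ∧
      toCLM l * toCLM i = toCLM q ∧ toCLM q * toCLM l = toCLM l := by
  obtain ⟨P, hPN', hP, ⟨e⟩⟩ := h
  have : Module.Finite A N := Module.Finite.iff_fg.mpr hfg
  have hPfg : P.FG := Module.Finite.iff_fg.mp (Module.Finite.equiv e.toLinearEquiv)
  obtain ⟨Q, hQ, hQC⟩ := exists_finiteRank_projection hN hfg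
  obtain ⟨Q', hQ', hQC'⟩ := exists_finiteRank_projection hP hPfg
  obtain ⟨q, hq, hqe⟩ := hQC N.subtypeL
  obtain ⟨i, hi, hie⟩ := hQC (P.subtypeL.comp (e : N →L[A] P))
  obtain ⟨l, hl, hle⟩ := hQC' (N.subtypeL.comp (e.symm : P →L[A] N))
  refine ⟨q, hq, i, hi, l, hl, ?_, ?_, ?_, ?_, ?_⟩
  · intro z hz
    rw [hqe]
    exact congrArg Subtype.val (hQ ⟨z, hz⟩)
  · intro z
    rw [hqe]
    exact (Q z).2
  · intro z
    rw [hie]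
    exact hPN' (e (Q z)).2
  · rw [hqe, hie, hle]
    ext z
    change ((e.symm (Q' (e (Q z) : P))) : E) = Q z
    rw [hQ', e.symm_apply_apply]
  · rw [hqe, hle]
    ext z
    change ((Q (e.symm (Q' z) : N)) : E) = _
    rw [hQ]
    rfl

theorem upperMinusPrime_subset [CompleteSpace E] :
    upperMinusPrime A E ⊆ leftInvertibleAddFiniteRank A E := by
  rintro F ⟨-, M₁, N₁, M₂, N₂, hdec, hfg, hle⟩
  obtain ⟨B, hB, hN₁, hN₂⟩ := hdec.exists_outer_inverse
  obtain ⟨q, hq, i, hi, l, -, hqN, hqmem, himem, hli, -⟩ :=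
    hle.exists_factorization hdec.closed_N₁ hfg
  rw [hN₁] at hqN hqmem
  rw [hN₂] at himem
  -- D is F on ker q, and on N₁ it is replaced by the embedding i into N₂.
  refine ⟨F - F * q + i, F * q - i, sub_mem (mul_mem_finiteRank F hq) hi, by abel, ?_⟩
  have h₁ : (1 - toCLM q) * (1 - B * toCLM F) = 0 :=
    one_sub_mul_one_sub_eq_zero (by rw [← mul_assoc, hB]) hqN
  have h₂ : B * toCLM F * toCLM q = 0 := ContinuousLinearMap.ext hqmem
  have h₃ : B * toCLM i = 0 := ContinuousLinearMap.ext himem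
  rw [toCLM_add, toCLM_sub, toCLM_mul]
  generalize toCLM F = f at *
  generalize toCLM q = q at *
  generalize toCLM i = i at *
  generalize toCLM l = l at *
  have h₄ : (1 - q) * B * (f - f * q + i) = 1 - q := by
    calc _ = (1 - q) - (1 - q) * (1 - B * f) - (1 - q) * (B * f * q) + (1 - q) * (B * i) := by
          noncomm_ring
      _ = 1 - q := by rw [h₁, h₂, h₃]; simp
  -- J₀ = (1 - q)B satisfies J₀D = 1 - q. The residue D - FJ₀D equals i, from which l recovers the
  -- missing q.
  refine ⟨(1 - q) * B + l * (1 - f * ((1 - q) * B)), ?_⟩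
  calc _ = (1 - q) * B * (f - f * q + i) + l * (f - f * q + i)
        - l * f * ((1 - q) * B * (f - f * q + i)) := by noncomm_ring
    _ = 1 - q + l * i := by rw [h₄]; noncomm_ring
    _ = 1 := by rw [hli]; abel

theorem lowerPlusPrime_subset [CompleteSpace E] :
    lowerPlusPrime A E ⊆ rightInvertibleAddFiniteRank A E := by
  rintro F ⟨-, M₁, N₁, M₂, N₂, hdec, hfg, hle⟩
  obtain ⟨B, hB, hN₁, hN₂⟩ := hdec.exists_outer_inverse
  obtain ⟨q, hq, i, -, l, hl, hqN, hqmem, himem, hli, hql⟩ :=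
    hle.exists_factorization hdec.closed_N₂ hfg
  rw [hN₂] at hqN hqmem
  rw [hN₁] at himem
  -- D is F with its N₂ component under q removed, and l, which maps onto N₂ through a copy of it in
  -- N₁, put in its place.
  refine ⟨F - q * F + l, q * F - l, sub_mem (finiteRank_mul_mem F hq) hl, by abel, ?_⟩
  have h₁ : (1 - toCLM q) * (1 - toCLM F * B) = 0 := by
    refine one_sub_mul_one_sub_eq_zero (by rw [mul_assoc, ← mul_assoc B, hB]) fun z hz => hqN z ?_
    rw [← hB]
    exact (congrArg B hz).trans (map_zero B)
  have h₃ : B * toCLM F * toCLM i = 0 := ContinuousLinearMap.ext himem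
  rw [toCLM_add, toCLM_sub, toCLM_mul]
  generalize toCLM F = f at *
  generalize toCLM q = q at *
  generalize toCLM i = i at *
  generalize toCLM l = l at *
  have h₄ : (f - q * f) * i = 0 := by
    calc _ = (1 - q) * (1 - f * B) * f * i + (1 - q) * f * (B * f * i) := by noncomm_ring
      _ = 0 := by rw [h₁, h₃]; simp
  -- DB = 1 - q + lB and Di = q, so the term i(1 - lB) supplies q and cancels lB, because ql = l.
  refine ⟨B + i * (1 - l * B), ?_⟩
  calc _ = (1 - q) - (1 - q) * (1 - f * B) + (f - q * f) * i * (1 - l * B) + l * B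
        + l * i * (1 - l * B) := by noncomm_ring
    _ = 1 - (q * l) * B + l * B := by rw [h₁, h₄, hli]; noncomm_ring
    _ = 1 := by rw [hql]; abel

theorem leftInvertibleAddFiniteRank_subset [CompleteSpace E]
    (happrox : HasFiniteRankApproximation A E) :
    leftInvertibleAddFiniteRank A E ⊆ upperMinusPrime A E := by
  rintro F ⟨D₀, C, hC, hF, J₀, hJ₀⟩
  obtain ⟨ε, hε, h⟩ := exists_left_inverse_add hJ₀
  obtain ⟨T, hT, hTfg, hlt, -⟩ := happrox C hC ε hε
  obtain ⟨J, hJ⟩ := h _ hlt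
  have hT' : toCLM T * toCLM T = toCLM T := by rw [← toCLM_mul, hT]
  set t := toCLM T
  set d := toCLM (D₀ + (C - C * T))
  set B : E →L[A] E := (1 - t) * J
  -- After C - CT is absorbed, F = d + Ct agrees with d on ker t.
  have hft : toCLM F * (1 - t) = d * (1 - t) := by
    have : toCLM F = d + toCLM C * t := by
      rw [← toCLM_mul, ← toCLM_add, hF]
      congr 1
      abel
    rw [this, add_mul, mul_assoc, mul_sub t, mul_one, hT', sub_self, mul_zero, add_zero]
  have hBt : B * toCLM F * (1 - t) = 1 - t := by
    calc _ = (1 - t) * J * (toCLM F * (1 - t)) := by rw [mul_assoc]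
      _ = (1 - t) * (J * d) * (1 - t) := by rw [hft]; noncomm_ring
      _ = 1 - t - t + t * t := by rw [hJ]; noncomm_ring
      _ = 1 - t := by rw [hT']; abel
  have hB : B * toCLM F * B = B := by
    calc _ = B * toCLM F * (1 - t) * J := by simp only [B, mul_assoc]
      _ = B := by rw [hBt]
  have hdec := isDecomposition_of_outer_inverse F B hB
  -- Hence ker BF, the range of 1 - BF, is the image of the finitely generated range of t.
  have hker : (1 - B * toCLM F) * t = 1 - B * toCLM F := by
    calc _ = 1 - B * toCLM F - (1 - t) + B * toCLM F * (1 - t) := by noncomm_ring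
      _ = _ := by rw [hBt]; abel
  have hid (z : E) (hz : z ∈ LinearMap.ker (B * toCLM F).toLinearMap) :
      (1 - B * toCLM F) (t z) = z := by
    calc _ = (1 - B * toCLM F) z := congrArg (fun f : E →L[A] E => f z) hker
      _ = z := by
        change z - (B * toCLM F) z = z
        rw [show (B * toCLM F) z = 0 from hz, sub_zero]
  have hfg : (LinearMap.ker (B * toCLM F).toLinearMap).FG := by
    have : LinearMap.ker (B * toCLM F).toLinearMap =
        (LinearMap.range t.toLinearMap).map (1 - B * toCLM F).toLinearMap := by
      ext z
      constructor
      · exact fun hz => ⟨t z, ⟨z, rfl⟩, hid z hz⟩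
      · rintro ⟨w, -, rfl⟩
        have : B * toCLM F * (1 - B * toCLM F) = 0 := by
          rw [mul_sub, mul_one, ← mul_assoc, hB, sub_self]
        exact congrArg (fun f : E →L[A] E => f w) this
    rw [this]
    exact hTfg.map _
  refine ⟨⟨_, _, _, _, hdec, hfg⟩, _, _, _, _, hdec, hfg,
    -- dt maps into ker B since Bdt = (1 - t)t = 0. It is injective on N₁ since (1 - BF)J undoes it
    -- there.
    preceq_of_leftInverse hdec.closed_N₁ (d * t) ((1 - B * toCLM F) * J) (fun z _ => ?_)
      fun z hz => ?_⟩
  · have : B * (d * t) = 0 := by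
      calc _ = (1 - t) * (J * d) * t := by simp only [B, mul_assoc]
        _ = t - t * t := by rw [hJ]; noncomm_ring
        _ = 0 := by rw [hT', sub_self]
    exact congrArg (fun f : E →L[A] E => f z) this
  · have : (1 - B * toCLM F) * J * (d * t) = (1 - B * toCLM F) * t := by
      rw [mul_assoc, ← mul_assoc J, hJ, one_mul]
    exact (congrArg (fun f : E →L[A] E => f z) this).trans (hid z hz)

theorem rightInvertibleAddFiniteRank_subset [CompleteSpace E]
    (happrox : HasFiniteRankApproximation A E) :
    rightInvertibleAddFiniteRank A E ⊆ lowerPlusPrime A E := by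
  rintro F ⟨D₀, C, hC, hF, R₀, hR₀⟩
  obtain ⟨ε, hε, h⟩ := exists_right_inverse_add hR₀
  obtain ⟨T, hT, hTfg, -, hlt⟩ := happrox C hC ε hε
  obtain ⟨R, hR⟩ := h _ hlt
  have hT' : toCLM T * toCLM T = toCLM T := by rw [← toCLM_mul, hT]
  set t := toCLM T
  set d := toCLM (D₀ + (C - T * C))
  set B : E →L[A] E := R * (1 - t)
  have htt : (1 - t) * (1 - t) = 1 - t := by
    calc _ = 1 - t - t + t * t := by noncomm_ring
      _ = 1 - t := by rw [hT']; abel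
  have htf : (1 - t) * toCLM F = (1 - t) * d := by
    have : toCLM F = d + t * toCLM C := by
      rw [← toCLM_mul, ← toCLM_add, hF]
      congr 1
      abel
    rw [this, mul_add, ← mul_assoc (1 - t), sub_mul 1 t t, one_mul, hT', sub_self, zero_mul,
      add_zero]
  have hB : B * toCLM F * B = B := by
    calc _ = R * ((1 - t) * toCLM F) * B := by simp only [B, mul_assoc]
      _ = R * (1 - t) * (d * R) * (1 - t) := by rw [htf]; simp only [B, mul_assoc]
      _ = R * ((1 - t) * (1 - t)) := by rw [hR, mul_one, mul_assoc]
      _ = B := by rw [htt]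
  have hdec := isDecomposition_of_outer_inverse F B hB
  have hdB : d * B = 1 - t := by rw [← mul_assoc, hR, one_mul]
  -- Here N₂ is exactly the range of t, because dB = 1 - t and Bt = 0.
  have hker : LinearMap.ker B.toLinearMap = LinearMap.range t.toLinearMap := by
    ext z
    constructor
    · intro hz
      have h₁ : (d * B) z = 0 := (congrArg d hz).trans (map_zero d)
      rw [hdB] at h₁
      exact ⟨z, (sub_eq_zero.mp h₁).symm⟩
    · rintro ⟨w, rfl⟩
      have : B * t = 0 := by
        rw [mul_assoc, sub_mul, one_mul, hT', sub_self, mul_zero]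
      exact congrArg (fun f : E →L[A] E => f w) this
  have hfg : (LinearMap.ker B.toLinearMap).FG := hker ▸ hTfg
  refine ⟨⟨_, _, _, _, hdec, hfg⟩, _, _, _, _, hdec, hfg,
    -- R embeds N₂ into N₁ = ker BF because BFR = B; its left inverse is d.
    preceq_of_leftInverse hdec.closed_N₂ R d (fun z hz => ?_) fun z _ => ?_⟩
  · have : B * toCLM F * R = B := by
      calc _ = R * ((1 - t) * toCLM F) * R := by simp only [B, mul_assoc]
        _ = R * (1 - t) * (d * R) := by rw [htf]; simp only [mul_assoc]
        _ = B := by rw [hR, mul_one]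
    exact (congrArg (fun f : E →L[A] E => f z) this).trans hz
  · exact congrArg (fun f : E →L[A] E => f z) hR

theorem upperMinusPrime_eq [CompleteSpace E] (happrox : HasFiniteRankApproximation A E) :
    upperMinusPrime A E = leftInvertibleAddFiniteRank A E :=
  upperMinusPrime_subset.antisymm (leftInvertibleAddFiniteRank_subset happrox)

theorem lowerPlusPrime_eq [CompleteSpace E] (happrox : HasFiniteRankApproximation A E) :
    lowerPlusPrime A E = rightInvertibleAddFiniteRank A E :=
  lowerPlusPrime_subset.antisymm (rightInvertibleAddFiniteRank_subset happrox)

end Characterization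

/-! ### Approximation by partial sums of an orthonormal basis -/

section OrthonormalBasis

open Filter Topology

variable {A E : Type*} [CStarAlgebra A] [PartialOrder A] [StarOrderedRing A]
  [NormedAddCommGroup E] [NormedSpace ℂ E] [Module A E] [CStarModule A E]

theorem norm_rankOne_le (x y : E) : ‖(rankOne x y : adjointable A E)‖ ≤ ‖y‖ * ‖x‖ := by
  refine ContinuousLinearMap.opNorm_le_bound _ (by positivity) fun z => ?_
  refine (norm_smul_le_mul (A := A) _ x).trans ?_
  rw [mul_right_comm]
  gcongr
  exact CStarModule.norm_inner_le E

variable (A) in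
/-- The partial sums of the series `∑ θ_{eᵢ,eᵢ}`. -/
noncomputable def frameSum (e : ℕ → E) (n : ℕ) : adjointable A E :=
  ∑ i ∈ Finset.range n, rankOne (e i) (e i)

theorem frameSum_apply (e : ℕ → E) (n : ℕ) (x : E) :
    toCLM (frameSum A e n) x = ∑ i ∈ Finset.range n, ⟪e i, x⟫_A • e i := by
  simp [frameSum, rankOne_apply]

theorem inner_frameSum_left (e : ℕ → E) (n : ℕ) (x y : E) :
    ⟪toCLM (frameSum A e n) x, y⟫_A = ⟪x, toCLM (frameSum A e n) y⟫_A := by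
  rw [frameSum_apply, frameSum_apply, CStarModule.inner_sum_left, CStarModule.inner_sum_right]
  simp

theorem frameSum_basis {e : ℕ → E} (he : ∀ i j, ⟪e i, e j⟫_A = if i = j then 1 else 0) {n i : ℕ}
    (hi : i ∈ Finset.range n) : toCLM (frameSum A e n) (e i) = e i := by
  rw [frameSum_apply, Finset.sum_eq_single_of_mem i hi fun j _ hj => ?_]
  · rw [he, if_pos rfl, one_smul]
  · rw [he, if_neg hj, zero_smul]

theorem frameSum_mul_self {e : ℕ → E} (he : ∀ i j, ⟪e i, e j⟫_A = if i = j then 1 else 0) (n : ℕ) :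
    frameSum A e n * frameSum A e n = frameSum A e n := by
  refine Subtype.ext (ContinuousLinearMap.ext fun x => ?_)
  change toCLM (frameSum A e n) (toCLM (frameSum A e n) x) = toCLM (frameSum A e n) x
  rw [frameSum_apply e n x, map_sum]
  refine Finset.sum_congr rfl fun i hi => ?_
  rw [map_smul, frameSum_basis he hi]

theorem range_frameSum_fg {e : ℕ → E} (he : ∀ i j, ⟪e i, e j⟫_A = if i = j then 1 else 0) (n : ℕ) :
    (LinearMap.range (toCLM (frameSum A e n)).toLinearMap).FG := by
  classical
  refine ⟨(Finset.range n).image e, le_antisymm (Submodule.span_le.mpr ?_) ?_⟩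
  · intro x hx
    obtain ⟨i, hi, rfl⟩ := Finset.mem_image.mp hx
    exact ⟨e i, frameSum_basis he hi⟩
  · rintro _ ⟨x, rfl⟩
    change toCLM (frameSum A e n) x ∈ _
    rw [frameSum_apply]
    exact sum_mem fun i hi => Submodule.smul_mem _ _
      (Submodule.subset_span (Finset.mem_image_of_mem _ hi))

theorem tendsto_frameSum {e : ℕ → E} (he : ∀ i j, ⟪e i, e j⟫_A = if i = j then 1 else 0) {x : E}
    (hx : HasSum (fun i => ⟪e i, x⟫_A * star ⟪e i, x⟫_A) ⟪x, x⟫_A) :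
    Tendsto (fun n => toCLM (frameSum A e n) x) atTop (𝓝 x) := by
  rw [tendsto_iff_norm_sub_tendsto_zero]
  -- The partial sum is a self-adjoint idempotent, so the squared error is the tail in Parseval's
  -- identity.
  have hsq (n : ℕ) : ‖toCLM (frameSum A e n) x - x‖ ^ 2 =
      ‖⟪x, x⟫_A - ∑ i ∈ Finset.range n, ⟪e i, x⟫_A * star ⟪e i, x⟫_A‖ := by
    have hT : toCLM (frameSum A e n) (toCLM (frameSum A e n) x) = toCLM (frameSum A e n) x :=
      congrArg (fun T => toCLM T x) (frameSum_mul_self he n)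
    have hxT : ⟪x, toCLM (frameSum A e n) x⟫_A =
        ∑ i ∈ Finset.range n, ⟪e i, x⟫_A * star ⟪e i, x⟫_A := by
      rw [frameSum_apply, CStarModule.inner_sum_right]
      refine Finset.sum_congr rfl fun i _ => ?_
      rw [CStarModule.inner_op_smul_right, CStarModule.star_inner]
    rw [CStarModule.norm_sq_eq A, CStarModule.inner_sub_left, CStarModule.inner_sub_right,
      CStarModule.inner_sub_right, inner_frameSum_left, inner_frameSum_left, hT, hxT]
    congr 1
    abel
  have h₀ : Tendsto (fun n => ‖toCLM (frameSum A e n) x - x‖ ^ 2) atTop (𝓝 0) := by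
    simp_rw [hsq]
    have := (hx.tendsto_sum_nat.const_sub ⟪x, x⟫_A).norm
    rwa [sub_self, norm_zero] at this
  simpa using h₀.sqrt

theorem tendsto_sub_mul_frameSum {e : ℕ → E}
    (he : ∀ x, Tendsto (fun n => toCLM (frameSum A e n) x) atTop (𝓝 x)) {C : adjointable A E}
    (hC : C ∈ finiteRank A E) :
    Tendsto (fun n => C - C * frameSum A e n) atTop (𝓝 0) := by
  induction hC using Submodule.span_induction with
  | mem C hC =>
    obtain ⟨⟨x, y⟩, rfl⟩ := hC
    have h (n : ℕ) : rankOne x y - rankOne x y * frameSum A e n =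
        rankOne x (y - toCLM (frameSum A e n) y) := by
      refine Subtype.ext (ContinuousLinearMap.ext fun z => ?_)
      change ⟪y, z⟫_A • x - ⟪y, toCLM (frameSum A e n) z⟫_A • x = ⟪y - toCLM (frameSum A e n) y, z⟫_A • x
      rw [CStarModule.inner_sub_left, sub_smul, inner_frameSum_left]
    refine squeeze_zero_norm (fun n => (congrArg norm (h n)).trans_le (norm_rankOne_le _ _)) ?_
    simpa using (((he y).const_sub y).norm.mul_const ‖x‖)
  | zero => simp
  | add C C' _ _ h h' =>
    simpa only [add_mul, add_sub_add_comm, add_zero] using h.add h'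
  | smul c C _ h =>
    simpa only [smul_mul_assoc, ← smul_sub, smul_zero] using h.const_smul c

theorem tendsto_sub_frameSum_mul {e : ℕ → E}
    (he : ∀ x, Tendsto (fun n => toCLM (frameSum A e n) x) atTop (𝓝 x)) {C : adjointable A E}
    (hC : C ∈ finiteRank A E) :
    Tendsto (fun n => C - frameSum A e n * C) atTop (𝓝 0) := by
  induction hC using Submodule.span_induction with
  | mem C hC =>
    obtain ⟨⟨x, y⟩, rfl⟩ := hC
    have h (n : ℕ) : rankOne x y - frameSum A e n * rankOne x y =
        rankOne (x - toCLM (frameSum A e n) x) y := by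
      refine Subtype.ext (ContinuousLinearMap.ext fun z => ?_)
      change ⟪y, z⟫_A • x - toCLM (frameSum A e n) (⟪y, z⟫_A • x) =
        ⟪y, z⟫_A • (x - toCLM (frameSum A e n) x)
      rw [map_smul, smul_sub]
    refine squeeze_zero_norm (fun n => (congrArg norm (h n)).trans_le (norm_rankOne_le _ _)) ?_
    simpa using (((he x).const_sub x).norm.const_mul ‖y‖)
  | zero => simp
  | add C C' _ _ h h' =>
    simpa only [mul_add, add_sub_add_comm, add_zero] using h.add h'
  | smul c C _ h =>
    simpa only [mul_smul_comm, ← smul_sub, smul_zero] using h.const_smul c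

/-- An orthonormal basis for which Parseval's identity holds gives finite rank approximations. -/
theorem hasFiniteRankApproximation_of_basis {e : ℕ → E}
    (he : ∀ i j, ⟪e i, e j⟫_A = if i = j then 1 else 0)
    (hsum : ∀ x, HasSum (fun i => ⟪e i, x⟫_A * star ⟪e i, x⟫_A) ⟪x, x⟫_A) :
    HasFiniteRankApproximation A E := by
  intro C hC ε hε
  have hlim (x : E) := tendsto_frameSum he (hsum x)
  obtain ⟨n, h₁, h₂⟩ := (((tendsto_sub_mul_frameSum hlim hC).norm.eventually_lt_const
    (by rwa [norm_zero])).and ((tendsto_sub_frameSum_mul hlim hC).norm.eventually_lt_const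
    (by rwa [norm_zero]))).exists
  exact ⟨frameSum A e n, frameSum_mul_self he n, range_frameSum_fg he n, h₁, h₂⟩

end OrthonormalBasis

/-! ### Completeness and the standard basis of ℓ²(A) -/

namespace StdModule

open Filter Topology

variable {A : Type*} [CStarAlgebra A] [PartialOrder A] [StarOrderedRing A]

theorem coord_sub (x y : StdModule A) (i : ℕ) : (x - y).coord i = x.coord i - y.coord i := rfl

theorem norm_sq_eq_tsum (x : StdModule A) :
    ‖x‖ ^ 2 = ‖∑' i, x.coord i * star (x.coord i)‖ := by
  rw [CStarModule.norm_sq_eq A, inner_def]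

/-- The restriction of a sequence to a finite set of indices, extended by zero. -/
noncomputable def truncate (s : Finset ℕ) (f : ℕ → A) : StdModule A :=
  ⟨fun i => if i ∈ s then f i else 0, summable_of_ne_finset_zero (s := s) fun i hi => by simp [hi]⟩

theorem coord_truncate (s : Finset ℕ) (f : ℕ → A) (i : ℕ) :
    (truncate s f).coord i = if i ∈ s then f i else 0 := rfl

theorem truncate_add (s : Finset ℕ) (f g : ℕ → A) :
    truncate s (f + g) = truncate s f + truncate s g := by
  refine ext_coord fun i => ?_
  rw [coord_add, coord_truncate, coord_truncate, coord_truncate]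
  split_ifs <;> simp

theorem norm_sq_truncate (s : Finset ℕ) (f : ℕ → A) :
    ‖truncate s f‖ ^ 2 = ‖∑ i ∈ s, f i * star (f i)‖ := by
  rw [norm_sq_eq_tsum, tsum_eq_sum (s := s) fun i hi => by simp [coord_truncate, hi]]
  congr 1
  refine Finset.sum_congr rfl fun i hi => ?_
  rw [coord_truncate, if_pos hi]

theorem norm_sum_le_norm_sq (x : StdModule A) (s : Finset ℕ) :
    ‖∑ i ∈ s, x.coord i * star (x.coord i)‖ ≤ ‖x‖ ^ 2 := by
  rw [norm_sq_eq_tsum]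
  exact CStarAlgebra.norm_le_norm_of_nonneg_of_le
    (Finset.sum_nonneg fun i _ => mul_star_self_nonneg _)
    (x.summable_self.sum_le_tsum s fun i _ => mul_star_self_nonneg _)

theorem norm_coord_le (x : StdModule A) (i : ℕ) : ‖x.coord i‖ ≤ ‖x‖ := by
  refine (pow_le_pow_iff_left₀ (norm_nonneg _) (norm_nonneg _) two_ne_zero).mp ?_
  rw [sq, ← CStarRing.norm_self_mul_star]
  simpa using norm_sum_le_norm_sq x {i}

theorem norm_sq_le_of_forall_norm_sum_le (x : StdModule A) {r : ℝ}
    (h : ∀ s : Finset ℕ, ‖∑ i ∈ s, x.coord i * star (x.coord i)‖ ≤ r) : ‖x‖ ^ 2 ≤ r := by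
  rw [norm_sq_eq_tsum]
  exact le_of_tendsto' x.summable_self.hasSum.norm h

instance : CompleteSpace (StdModule A) := by
  refine Metric.complete_of_cauchySeq_tendsto fun u hu => ?_
  have hcoord (i : ℕ) : CauchySeq fun k => (u k).coord i := by
    rw [Metric.cauchySeq_iff] at hu ⊢
    intro ε hε
    obtain ⟨N, hN⟩ := hu ε hε
    refine ⟨N, fun m hm n hn => lt_of_le_of_lt ?_ (hN m hm n hn)⟩
    rw [dist_eq_norm, dist_eq_norm, ← coord_sub]
    exact norm_coord_le _ i
  choose f hf using fun i => cauchySeq_tendsto_of_complete (hcoord i)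
  -- The Cauchy estimate passes to the coordinatewise limit on each finite set of indices, with N
  -- independent of that set.
  have key (ε : ℝ) (hε : 0 < ε) : ∃ N, ∀ k ≥ N, ∀ s : Finset ℕ,
      ‖∑ i ∈ s, ((u k).coord i - f i) * star ((u k).coord i - f i)‖ ≤ ε ^ 2 := by
    obtain ⟨N, hN⟩ := Metric.cauchySeq_iff.mp hu ε hε
    refine ⟨N, fun k hk s => ?_⟩
    have hlim : Tendsto (fun l => ‖∑ i ∈ s, ((u k).coord i - (u l).coord i) *
        star ((u k).coord i - (u l).coord i)‖) atTop
        (𝓝 ‖∑ i ∈ s, ((u k).coord i - f i) * star ((u k).coord i - f i)‖) :=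
      (tendsto_finsetSum s fun i _ =>
        ((hf i).const_sub _).mul ((hf i).const_sub _).star).norm
    refine le_of_tendsto hlim ?_
    filter_upwards [eventually_ge_atTop N] with l hl
    refine (norm_sum_le_norm_sq (u k - u l) s).trans ?_
    rw [← dist_eq_norm]
    have := (hN k hk l hl).le
    gcongr
  have hsum : Summable fun i => f i * star (f i) := by
    rw [summable_iff_vanishing_norm]
    intro ε hε
    -- The tails of f are compared with those of u N by the triangle inequality for ‖·‖; the two
    -- halves add to √ε, whose square is ε.
    have hδ : 0 < √ε / 2 := by positivity
    obtain ⟨N, hN⟩ := key _ hδ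
    obtain ⟨s, hs⟩ := summable_iff_vanishing_norm.mp (u N).summable_self ((√ε / 2) ^ 2)
      (by positivity)
    refine ⟨s, fun t ht => ?_⟩
    have h₁ : ‖truncate t (u N).coord‖ < √ε / 2 :=
      lt_of_pow_lt_pow_left₀ 2 hδ.le ((norm_sq_truncate _ _).trans_lt (hs t ht))
    have h₂ : ‖truncate t fun i => (u N).coord i - f i‖ ≤ √ε / 2 :=
      (pow_le_pow_iff_left₀ (norm_nonneg _) hδ.le two_ne_zero).mp
        ((norm_sq_truncate _ _).trans_le (hN N le_rfl t))
    have h₃ : truncate t f + (truncate t fun i => (u N).coord i - f i) =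
        truncate t (u N).coord := by
      rw [← truncate_add]
      congr 1
      funext i
      simp
    have h₄ : ‖truncate t f‖ < √ε := by
      rw [eq_sub_of_add_eq h₃]
      refine (norm_sub_le _ _).trans_lt ?_
      linarith
    rw [← norm_sq_truncate, ← Real.sq_sqrt hε.le]
    gcongr
  let y : StdModule A := ⟨f, hsum⟩
  refine ⟨y, Metric.tendsto_atTop.mpr fun ε hε => ?_⟩
  obtain ⟨N, hN⟩ := key (ε / 2) (by positivity)
  refine ⟨N, fun k hk => ?_⟩
  rw [dist_eq_norm]
  refine lt_of_le_of_lt ((pow_le_pow_iff_left₀ (norm_nonneg _) (by positivity) two_ne_zero).mp ?_)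
    (half_lt_self hε)
  exact norm_sq_le_of_forall_norm_sum_le (u k - y) (hN k hk)

/-- The standard basis of `H_A`. -/
noncomputable def basisVec (i : ℕ) : StdModule A := truncate {i} 1

theorem inner_basisVec (i : ℕ) (x : StdModule A) : ⟪basisVec i, x⟫_A = x.coord i := by
  rw [inner_def, tsum_eq_single i]
  · simp [basisVec, coord_truncate]
  · intro j hj
    simp [basisVec, coord_truncate, hj]

/-- Pairing with the basis gives coordinates, so Parseval's identity is the definition of the inner
product. -/
theorem hasFiniteRankApproximation : HasFiniteRankApproximation A (StdModule A) := by
  refine hasFiniteRankApproximation_of_basis (e := basisVec) (fun i j => ?_) fun x => ?_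
  · rw [inner_basisVec, basisVec, coord_truncate]
    simp
  · simp_rw [inner_basisVec]
    exact x.summable_self.hasSum

end StdModule

end HilbertModule

theorem lemma5p9 {A : Type*} [CStarAlgebra A] [PartialOrder A] [StarOrderedRing A] :
    IsOpen (HilbertModule.upperMinusPrime A (HilbertModule.StdModule A)) ∧
    IsOpen (HilbertModule.lowerPlusPrime A (HilbertModule.StdModule A)) ∧
    (∀ F ∈ HilbertModule.upperMinusPrime A (HilbertModule.StdModule A),
      ∀ K ∈ HilbertModule.compactOperators A (HilbertModule.StdModule A),
        F + K ∈ HilbertModule.upperMinusPrime A (HilbertModule.StdModule A)) ∧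
    (∀ F ∈ HilbertModule.lowerPlusPrime A (HilbertModule.StdModule A),
      ∀ K ∈ HilbertModule.compactOperators A (HilbertModule.StdModule A),
        F + K ∈ HilbertModule.lowerPlusPrime A (HilbertModule.StdModule A)) := by
  rw [HilbertModule.upperMinusPrime_eq HilbertModule.StdModule.hasFiniteRankApproximation,
    HilbertModule.lowerPlusPrime_eq HilbertModule.StdModule.hasFiniteRankApproximation]
  exact ⟨HilbertModule.isOpen_leftInvertibleAddFiniteRank,
    HilbertModule.isOpen_rightInvertibleAddFiniteRank,
    fun _ hF _ hK => HilbertModule.add_compact_mem_leftInvertibleAddFiniteRank hF hK,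
    fun _ hF _ hK => HilbertModule.add_compact_mem_rightInvertibleAddFiniteRank hF hK⟩
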